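/- Let $G$ be a finite biconnected graph (every two distinct vertices are joined by two different paths sharing only their ends). A \emph{rectilinear drawing} $\Gamma$ of $G$ places the vertices at distinct points of the Euclidean plane and draws each edge as a horizontal or a vertical segment, such that two edges meet only in common end-vertices. Two rectilinear drawings of $G$ are \emph{shape equivalent} if they have the same clockwise order of edges around each vertex and the same geometric angles at each vertex; an equivalence class $H$ is called a \emph{rectilinear representation} of $G$, and its members are the drawings of $H$. Call $H$ \emph{convex} if all internal faces are rectangles and the external face is bounded by an orthoconvex polygon, that is, a polygon whose closed region meets every horizontal and every vertical line in the empty set or a single segment (whether this holds does not depend on the choice of the drawing of $H$). A drawing is \emph{greedy} if for every ordered pair of vertices $u,v$ there is a path $u=v_0,v_1,\dots,v_k=v$ in $G$ with $d(v_{i+1},v)<d(v_i,v)$ for all $i<k$, where $d$ is the Euclidean distance of the vertices in the drawing; $H$ is \emph{universal greedy} if every rectilinear drawing of $H$ is greedy. A \emph{staircase path} of $H$ is a path along which both the $x$-coordinate and the $y$-coordinate are (weakly) monotone in the drawings of $H$. Let $H$ be a convex rectilinear representation of a biconnected graph. Then $H$ is universal greedy if and only if every two vertices of $H$ are joined by a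 staircase path. -/

import Mathlib

/-- A graph is biconnected if every two distinct vertices are joined by two different paths that
share no vertex besides their two ends. -/
def IsBiconnected {V : Type*} (G : SimpleGraph V) : Prop :=
  ∀ u v : V, u ≠ v → ∃ p q : G.Walk u v, p.IsPath ∧ q.IsPath ∧ p ≠ q ∧
    ∀ w : V, w ∈ p.support → w ∈ q.support → w = u ∨ w = v

/-- A planar rectilinear drawing of `G`: vertices are distinct points of the Euclidean plane, the
edge `uv` is the segment between the points of `u` and `v`, every edge is horizontal or vertical,
and two different edges meet only in common end-vertices. -/
structure RectilinearDrawing {V : Type*} (G : SimpleGraph V) where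
  pos : V → EuclideanSpace ℝ (Fin 2)
  pos_injective : Function.Injective pos
  rectilinear : ∀ u v : V, G.Adj u v → pos u 0 = pos v 0 ∨ pos u 1 = pos v 1
  planar : ∀ u v a b : V, G.Adj u v → G.Adj a b → s(u, v) ≠ s(a, b) →
    ∀ z ∈ segment ℝ (pos u) (pos v) ∩ segment ℝ (pos a) (pos b),
      ∃ w : V, (w = u ∨ w = v) ∧ (w = a ∨ w = b) ∧ z = pos w

namespace RectilinearDrawing

/-- The `x`-coordinate of a vertex. -/
def x {V : Type*} {G : SimpleGraph V} (Γ : RectilinearDrawing G) (v : V) : ℝ := Γ.pos v 0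

/-- The `y`-coordinate of a vertex. -/
def y {V : Type*} {G : SimpleGraph V} (Γ : RectilinearDrawing G) (v : V) : ℝ := Γ.pos v 1

open Classical in
/-- The direction in which the edge `va` leaves `v`, in counterclockwise quarter turns from the
positive `x`-axis: `0` right, `1` up, `2` left, `3` down. Used for adjacent `v` and `a` only. -/
noncomputable def dir {V : Type*} {G : SimpleGraph V} (Γ : RectilinearDrawing G) (v a : V) :
    ZMod 4 :=
  if Γ.y a = Γ.y v then (if Γ.x v < Γ.x a then 0 else 2) else (if Γ.y v < Γ.y a then 1 else 3)

/-- The clockwise angle at `v` from the edge `va` to the edge `vb`, in quarter turns. -/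
noncomputable def angle {V : Type*} {G : SimpleGraph V} (Γ : RectilinearDrawing G) (v a b : V) :
    ZMod 4 :=
  Γ.dir v a - Γ.dir v b

/-- Two drawings are shape equivalent if all angles between two edges at a common vertex agree.
As all pairs of edges at a vertex are compared, this includes that the clockwise order of the
edges around each vertex is the same. For connected graphs the two drawings therefore have the
same face boundaries, and the same external face, because the angles along a face boundary tell
whether the face is internal. -/
def ShapeEquivalent {V : Type*} {G : SimpleGraph V} (Γ Γ' : RectilinearDrawing G) : Prop :=
  ∀ v a b : V, G.Adj v a → G.Adj v b → Γ.angle v a b = Γ'.angle v a b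

/-- The set of points covered by the drawing. -/
def carrier {V : Type*} {G : SimpleGraph V} (Γ : RectilinearDrawing G) :
    Set (EuclideanSpace ℝ (Fin 2)) :=
  {z | (∃ v : V, z = Γ.pos v) ∨ ∃ u v : V, G.Adj u v ∧ z ∈ segment ℝ (Γ.pos u) (Γ.pos v)}

/-- The faces of a drawing: the connected components of the complement of the drawing. -/
def IsFace {V : Type*} {G : SimpleGraph V} (Γ : RectilinearDrawing G)
    (F : Set (EuclideanSpace ℝ (Fin 2))) : Prop :=
  ∃ z ∈ Γ.carrierᶜ, F = connectedComponentIn Γ.carrierᶜ z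

/-- Internal faces are the bounded ones. -/
def IsInternalFace {V : Type*} {G : SimpleGraph V} (Γ : RectilinearDrawing G)
    (F : Set (EuclideanSpace ℝ (Fin 2))) : Prop :=
  Γ.IsFace F ∧ Bornology.IsBounded F

/-- The external face is the unbounded one. -/
def IsExternalFace {V : Type*} {G : SimpleGraph V} (Γ : RectilinearDrawing G)
    (F : Set (EuclideanSpace ℝ (Fin 2))) : Prop :=
  Γ.IsFace F ∧ ¬ Bornology.IsBounded F

end RectilinearDrawing

/-- The interior of an axis-parallel rectangle. -/
def IsOpenRectangle (F : Set (EuclideanSpace ℝ (Fin 2))) : Prop :=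
  ∃ a b c d : ℝ, a < b ∧ c < d ∧ F = {z | a < z 0 ∧ z 0 < b ∧ c < z 1 ∧ z 1 < d}

/-- Every vertical and every horizontal line meets `P` in the empty set or in a single segment. -/
def IsOrthoconvex (P : Set (EuclideanSpace ℝ (Fin 2))) : Prop :=
  ∀ (i : Fin 2) (t : ℝ), P ∩ {z | z i = t} = ∅ ∨
    ∃ p q : EuclideanSpace ℝ (Fin 2), P ∩ {z | z i = t} = segment ℝ p q

namespace RectilinearDrawing

/-- All internal faces are rectangles, and the external face is bounded by an orthoconvex polygon;
the polygon, with its inside, is the complement of the external face. -/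
def IsConvex {V : Type*} {G : SimpleGraph V} (Γ : RectilinearDrawing G) : Prop :=
  (∀ F, Γ.IsInternalFace F → IsOpenRectangle F) ∧ ∀ F, Γ.IsExternalFace F → IsOrthoconvex Fᶜ

/-- A path to `v` is distance-decreasing if each step lowers the Euclidean distance to `v`. -/
def IsDistanceDecreasing {V : Type*} {G : SimpleGraph V} (Γ : RectilinearDrawing G) {u v : V}
    (p : G.Walk u v) : Prop :=
  p.IsPath ∧ ∀ d ∈ p.darts, dist (Γ.pos d.snd) (Γ.pos v) < dist (Γ.pos d.fst) (Γ.pos v)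

/-- A drawing is greedy if there is a distance-decreasing path for each ordered pair of
vertices. -/
def IsGreedy {V : Type*} {G : SimpleGraph V} (Γ : RectilinearDrawing G) : Prop :=
  ∀ u v : V, ∃ p : G.Walk u v, Γ.IsDistanceDecreasing p

/-- A staircase path: both coordinates are (weakly) monotone along the path. -/
def IsStaircase {V : Type*} {G : SimpleGraph V} (Γ : RectilinearDrawing G) {u v : V}
    (p : G.Walk u v) : Prop :=
  p.IsPath ∧
    ((∀ d ∈ p.darts, Γ.x d.fst ≤ Γ.x d.snd) ∨ ∀ d ∈ p.darts, Γ.x d.snd ≤ Γ.x d.fst) ∧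
    ((∀ d ∈ p.darts, Γ.y d.fst ≤ Γ.y d.snd) ∨ ∀ d ∈ p.darts, Γ.y d.snd ≤ Γ.y d.fst)

end RectilinearDrawing

/-- Shape equivalence as an equivalence relation. -/
def shapeSetoid {V : Type*} (G : SimpleGraph V) : Setoid (RectilinearDrawing G) where
  r := RectilinearDrawing.ShapeEquivalent
  iseqv :=
    ⟨fun _ _ _ _ _ _ => rfl, fun h v a b ha hb => (h v a b ha hb).symm,
      fun h h' v a b ha hb => (h v a b ha hb).trans (h' v a b ha hb)⟩

/-- A rectilinear representation of `G` is a shape equivalence class of rectilinear drawings. -/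
def RectilinearRepresentation {V : Type*} (G : SimpleGraph V) : Type _ :=
  Quotient (shapeSetoid G)

namespace RectilinearRepresentation

/-- `Γ` is a drawing of the representation `H`. -/
def IsDrawing {V : Type*} {G : SimpleGraph V} (H : RectilinearRepresentation G)
    (Γ : RectilinearDrawing G) : Prop :=
  Quotient.mk (shapeSetoid G) Γ = H

/-- `H` is convex if its internal faces are rectangular and its external face is bounded by an
orthoconvex polygon. Both depend on the angles only, so that it does not matter in which drawing
of `H` they are tested. -/
def IsConvex {V : Type*} {G : SimpleGraph V} (H : RectilinearRepresentation G) : Prop :=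
  ∃ Γ : RectilinearDrawing G, H.IsDrawing Γ ∧ Γ.IsConvex

/-- `H` is universal greedy if every drawing of `H` is greedy. -/
def IsUniversalGreedy {V : Type*} {G : SimpleGraph V} (H : RectilinearRepresentation G) : Prop :=
  ∀ Γ : RectilinearDrawing G, H.IsDrawing Γ → Γ.IsGreedy

/-- A staircase path of `H` is a path that is a staircase in every drawing of `H`. -/
def IsStaircase {V : Type*} {G : SimpleGraph V} (H : RectilinearRepresentation G) {u v : V}
    (p : G.Walk u v) : Prop :=
  ∀ Γ : RectilinearDrawing G, H.IsDrawing Γ → Γ.IsStaircase p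

end RectilinearRepresentation

/-! A staircase towards `v` never overshoots `v` in either coordinate, so each step weakly lowers
both coordinate distances and strictly lowers one. Staircases are therefore distance-decreasing in
every drawing.

For the converse, work in a convex drawing, reflected so that `u` is weakly left of and below `v`.
The goal is a path of rightward and upward edges. Let R be the set of vertices that such paths reach
from `u`, and T the set of points weakly left of and above some vertex of R. By convexity, a vertex
without right and up edges is alone in its upper right quadrant (`IsConvex.quadrant`). Hence no
horizontal edge crosses the boundary of T (`leftAbove_iff`), and T can be lifted without changing
the shape (`deform`).

If `v` were outside T, lift T until `u` is level with `v` and stretch the drawing vertically. A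
greedy path from `u` to `v` must then keep to this height, hence to T, a contradiction
(`leftAbove_of_le`). By symmetry, `v` is also weakly right of and below a vertex of R. A descent to
the left and down shows that `v` is in R (`reflTransGen_of_leftAbove`).

The resulting path uses only two consecutive directions. Drawings of one shape differ by a rotation
of the directions, so it is a staircase in all of them. -/

open Set Relation

/-! ### Planar layouts and their deformations -/

/-- Coordinates `X`, `Y` of the vertices that form a planar rectilinear drawing of `G`; the edge
`uv` is the axis-parallel box spanned by its ends. -/
structure IsPlanarLayout {V : Type*} (G : SimpleGraph V) (X Y : V → ℝ) : Prop where
  inj : ∀ a b, X a = X b → Y a = Y b → a = b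
  rect : ∀ a b, G.Adj a b → X a = X b ∨ Y a = Y b
  planar : ∀ u v a b, G.Adj u v → G.Adj a b → s(u, v) ≠ s(a, b) → ∀ p q : ℝ,
    p ∈ uIcc (X u) (X v) → q ∈ uIcc (Y u) (Y v) → p ∈ uIcc (X a) (X b) → q ∈ uIcc (Y a) (Y b) →
    ∃ w, (w = u ∨ w = v) ∧ (w = a ∨ w = b) ∧ p = X w ∧ q = Y w

/-- Every edge has the same direction in both layouts. -/
def SameDirections {V : Type*} (G : SimpleGraph V) (X Y X' Y' : V → ℝ) : Prop :=
  ∀ a b, G.Adj a b → (X a < X b ↔ X' a < X' b) ∧ (Y a < Y b ↔ Y' a < Y' b)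

/-- A layout, all of whose deformations are greedy, in which a vertex without edges into two
consecutive directions is alone in the closed quadrant spanned by these directions. -/
structure IsGreedyConvexLayout {V : Type*} (G : SimpleGraph V) (X Y : V → ℝ) : Prop where
  layout : IsPlanarLayout G X Y
  quadrant : ∀ s t : ℝ, (s = 1 ∨ s = -1) → (t = 1 ∨ t = -1) → ∀ v u,
    (∀ a, G.Adj v a → s * (X a - X v) ≤ 0 ∧ t * (Y a - Y v) ≤ 0) →
    0 ≤ s * (X u - X v) → 0 ≤ t * (Y u - Y v) → u = v
  exists_adj : ∀ v, ∃ a, G.Adj v a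
  greedy : ∀ X' Y', IsPlanarLayout G X' Y' → SameDirections G X Y X' Y' → ∀ u v,
    ∃ p : G.Walk u v, ∀ d ∈ p.darts,
      (X' d.snd - X' v) ^ 2 + (Y' d.snd - Y' v) ^ 2 < (X' d.fst - X' v) ^ 2 + (Y' d.fst - Y' v) ^ 2

namespace IsPlanarLayout

variable {V : Type*} {G : SimpleGraph V} {X Y : V → ℝ}

theorem swap (h : IsPlanarLayout G X Y) : IsPlanarLayout G Y X where
  inj a b h1 h2 := h.inj a b h2 h1
  rect a b hab := (h.rect a b hab).symm
  planar u v a b h1 h2 h3 p q hp hq hp' hq' := by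
    obtain ⟨w, hw, hw', e1, e2⟩ := h.planar u v a b h1 h2 h3 q p hq hp hq' hp'
    exact ⟨w, hw, hw', e2, e1⟩

theorem neg_mem_uIcc {p a b : ℝ} (h : p ∈ uIcc (-a) (-b)) : -p ∈ uIcc a b := by
  rw [mem_uIcc] at h ⊢
  rcases h with h | h
  · right; constructor <;> linarith [h.1, h.2]
  · left; constructor <;> linarith [h.1, h.2]

theorem neg (h : IsPlanarLayout G X Y) : IsPlanarLayout G (fun v => -X v) Y where
  inj a b h1 h2 := h.inj a b (neg_injective h1) h2
  rect a b hab := (h.rect a b hab).imp (congrArg Neg.neg) id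
  planar u v a b h1 h2 h3 p q hp hq hp' hq' := by
    obtain ⟨w, hw, hw', e1, e2⟩ := h.planar u v a b h1 h2 h3 (-p) q (neg_mem_uIcc hp) hq
      (neg_mem_uIcc hp') hq'
    exact ⟨w, hw, hw', by rw [← e1, neg_neg], e2⟩

/-- A vertex on an edge is one of its ends. -/
theorem eq_or_eq_of_mem (h : IsPlanarLayout G X Y) {s s' a b : V} (hs : G.Adj s s')
    (hab : G.Adj a b) (hx : X s ∈ uIcc (X a) (X b)) (hy : Y s ∈ uIcc (Y a) (Y b)) :
    s = a ∨ s = b := by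
  by_cases e : s(s, s') = s(a, b)
  · have : s ∈ s(a, b) := e ▸ Sym2.mem_mk_left s s'
    simpa using this
  · obtain ⟨w, -, hw, e1, e2⟩ := h.planar s s' a b hs hab e _ _ left_mem_uIcc left_mem_uIcc hx hy
    rwa [h.inj s w e1 e2]

/-- A horizontal and a vertical edge meet in a common end only. -/
theorem exists_common_end (h : IsPlanarLayout G X Y) {a b c d : V} (hab : G.Adj a b)
    (hcd : G.Adj c d) (hY : Y a = Y b) (hX : X c = X d) (h1 : X a ≤ X c) (h2 : X c ≤ X b)
    (h3 : Y c ≤ Y a) (h4 : Y a ≤ Y d) :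
    ∃ w, (w = a ∨ w = b) ∧ (w = c ∨ w = d) ∧ X w = X c ∧ Y w = Y a := by
  have hne : s(a, b) ≠ s(c, d) := by
    intro e
    have ha : a ∈ s(c, d) := e ▸ Sym2.mem_mk_left a b
    have hb : b ∈ s(c, d) := e ▸ Sym2.mem_mk_right a b
    have : X a = X b := by
      rcases Sym2.mem_iff.1 ha with rfl | rfl <;> rcases Sym2.mem_iff.1 hb with rfl | rfl <;>
        simp [hX]
    exact hab.ne (h.inj _ _ this hY)
  obtain ⟨w, hw, hw', e1, e2⟩ := h.planar a b c d hab hcd hne (X c) (Y a)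
    (mem_uIcc_of_le h1 h2) left_mem_uIcc left_mem_uIcc (mem_uIcc_of_le h3 h4)
  exact ⟨w, hw, hw', e1.symm, e2.symm⟩

/-- Strictly monotone maps of the vertical lines that agree along every edge take a planar layout
to a planar layout. -/
theorem deform (h : IsPlanarLayout G X Y) {Y' : V → ℝ} {φ : ℝ → ℝ → ℝ}
    (hφ : ∀ p, StrictMono (φ p)) (hY : ∀ v, Y' v = φ (X v) (Y v))
    (he : ∀ u v, G.Adj u v → ∀ p ∈ uIcc (X u) (X v), Y' u = φ p (Y u)) :
    IsPlanarLayout G X Y' ∧ SameDirections G X Y X Y' := by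
  have he' : ∀ u v, G.Adj u v → ∀ p ∈ uIcc (X u) (X v), Y' v = φ p (Y v) := fun u v huv p hp =>
    he v u huv.symm p (by rwa [uIcc_comm])
  refine ⟨⟨fun a b h1 h2 => ?_, fun a b hab => ?_, ?_⟩, fun a b hab => ⟨Iff.rfl, ?_⟩⟩
  · rw [hY, hY, h1] at h2
    exact h.inj a b h1 ((hφ _).injective h2)
  · refine (h.rect a b hab).imp id fun e => ?_
    rw [he a b hab (X a) left_mem_uIcc, he' a b hab (X a) left_mem_uIcc, e]
  · intro u v a b huv hab hne p q hp hq hp' hq'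
    rw [he u v huv p hp, he' u v huv p hp] at hq
    rw [he a b hab p hp', he' a b hab p hp'] at hq'
    rw [uIcc, ← (hφ p).monotone.map_min, ← (hφ p).monotone.map_max] at hq hq'
    -- Before the deformation the two edges overlap on the vertical line at `p` in the interval from
    -- `m` to `M`. Both ends of it are common end-vertices; if these differed, the edges would be
    -- equal. So the overlap is one vertex.
    set m := max (min (Y u) (Y v)) (min (Y a) (Y b)) with hm
    set M := min (max (Y u) (Y v)) (max (Y a) (Y b)) with hM
    have hmq : φ p m ≤ q := by
      rw [hm, (hφ p).monotone.map_max]; exact max_le hq.1 hq'.1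
    have hMq : q ≤ φ p M := by
      rw [hM, (hφ p).monotone.map_min]; exact le_min hq.2 hq'.2
    have hmM : m ≤ M := (hφ p).le_iff_le.1 (hmq.trans hMq)
    have key : ∀ r, m ≤ r → r ≤ M →
        ∃ w, (w = u ∨ w = v) ∧ (w = a ∨ w = b) ∧ p = X w ∧ r = Y w := fun r h1 h2 =>
      h.planar u v a b huv hab hne p r hp
        ⟨(le_max_left _ _).trans h1, h2.trans (min_le_left _ _)⟩ hp'
        ⟨(le_max_right _ _).trans h1, h2.trans (min_le_right _ _)⟩
    obtain ⟨w, hw, hw', e1, e2⟩ := key m le_rfl hmM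
    obtain ⟨w₂, hw₂, hw₂', -, e4⟩ := key M hmM le_rfl
    have hww : w = w₂ := by
      by_contra hww
      apply hne
      have f1 : s(u, v) = s(w, w₂) :=
        ((Sym2.mem_and_mem_iff hww).1 ⟨Sym2.mem_iff.2 hw, Sym2.mem_iff.2 hw₂⟩)
      have f2 : s(a, b) = s(w, w₂) :=
        ((Sym2.mem_and_mem_iff hww).1 ⟨Sym2.mem_iff.2 hw', Sym2.mem_iff.2 hw₂'⟩)
      rw [f1, f2]
    refine ⟨w, hw, hw', e1, ?_⟩
    rw [hY, ← e1, ← e2]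
    refine le_antisymm ?_ hmq
    rwa [e2, hww, ← e4]
  · rw [he a b hab (X a) left_mem_uIcc, he' a b hab (X a) left_mem_uIcc, (hφ _).lt_iff_lt]

end IsPlanarLayout

/-! ### Up-right paths in greedy convex layouts -/

/-- The edge from `a` to `b` leads neither to the left nor down. -/
def UpRight {V : Type*} (G : SimpleGraph V) (X Y : V → ℝ) (a b : V) : Prop :=
  G.Adj a b ∧ X a ≤ X b ∧ Y a ≤ Y b

theorem UpRight.swap {V : Type*} {G : SimpleGraph V} {X Y : V → ℝ} {u v : V}
    (h : ReflTransGen (UpRight G X Y) u v) : ReflTransGen (UpRight G Y X) u v :=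
  ReflTransGen.mono (fun _ _ h => ⟨h.1, h.2.2, h.2.1⟩) _ _ h

theorem UpRight.le {V : Type*} {G : SimpleGraph V} {X Y : V → ℝ} {u v : V}
    (h : ReflTransGen (UpRight G X Y) u v) : X u ≤ X v ∧ Y u ≤ Y v := by
  induction h with
  | refl => exact ⟨le_rfl, le_rfl⟩
  | tail _ h ih => exact ⟨ih.1.trans h.2.1, ih.2.trans h.2.2⟩

/-- The points that lie weakly to the left of and weakly above some vertex that can be reached from
`u` by edges leading right or up. -/
def leftAbove {V : Type*} (G : SimpleGraph V) (X Y : V → ℝ) (u : V) (p q : ℝ) : Prop :=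
  ∃ r, ReflTransGen (UpRight G X Y) u r ∧ p ≤ X r ∧ Y r ≤ q

namespace IsGreedyConvexLayout

variable {V : Type*} {G : SimpleGraph V} {X Y : V → ℝ}

theorem swap (h : IsGreedyConvexLayout G X Y) : IsGreedyConvexLayout G Y X where
  layout := h.layout.swap
  quadrant s t hs ht v u ha h1 h2 :=
    h.quadrant t s ht hs v u (fun a hva => (ha a hva).symm) h2 h1
  exists_adj := h.exists_adj
  greedy X' Y' hd hs u v := by
    obtain ⟨p, hp⟩ := h.greedy Y' X' hd.swap (fun a b hab => (hs a b hab).symm) u v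
    refine ⟨p, fun d hd => ?_⟩
    have := hp d hd
    linarith

theorem neg (h : IsGreedyConvexLayout G X Y) : IsGreedyConvexLayout G (fun v => -X v) Y where
  layout := h.layout.neg
  quadrant s t hs ht v u ha h1 h2 :=
    h.quadrant (-s) t (by rcases hs with rfl | rfl <;> simp) ht v u
      (fun a hva => ⟨by linarith [(ha a hva).1], (ha a hva).2⟩) (by linarith) h2
  exists_adj := h.exists_adj
  greedy X' Y' hd hs u v := by
    have hs' : SameDirections G X Y (fun v => -X' v) Y' := fun a b hab =>
      ⟨by simpa only [neg_lt_neg_iff] using (hs b a hab.symm).1, (hs a b hab).2⟩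
    obtain ⟨p, hp⟩ := h.greedy _ Y' hd.neg hs' u v
    refine ⟨p, fun d hd => ?_⟩
    have := hp d hd
    nlinarith

variable [Finite V]

/-- Among the reached `r` that put `a` into the region, take one with `X r + Y r` largest. If `b`
escaped, it would lie in the upper right quadrant of `r`, so `r` has an edge to the right or up. A
right edge contradicts maximality. An up edge must end strictly above `ab`, so by planarity `r = a`,
and then `b` is reached as well. -/
theorem leftAbove_right (h : IsGreedyConvexLayout G X Y) {u a b : V} (hab : G.Adj a b)
    (hY : Y a = Y b) (hX : X a ≤ X b) (ha : leftAbove G X Y u (X a) (Y a)) :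
    leftAbove G X Y u (X b) (Y b) := by
  obtain ⟨r, ⟨hr, har, hra⟩, hmax⟩ := (toFinite
    {r | ReflTransGen (UpRight G X Y) u r ∧ X a ≤ X r ∧ Y r ≤ Y a}).exists_maximalFor
      (fun r => X r + Y r) _ ha
  by_contra hb
  have hrb : X r < X b := not_le.1 fun hle => hb ⟨r, hr, hle, hY ▸ hra⟩
  by_cases hsink : ∀ c, G.Adj r c → X c ≤ X r ∧ Y c ≤ Y r
  · have := h.quadrant 1 1 (Or.inl rfl) (Or.inl rfl) r b
      (fun c hc => ⟨by linarith [(hsink c hc).1], by linarith [(hsink c hc).2]⟩)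
      (by linarith) (by linarith)
    exact hrb.ne' (congrArg X this)
  · push Not at hsink
    obtain ⟨c, hrc, hc⟩ := hsink
    have hmax' : ReflTransGen (UpRight G X Y) u c → X a ≤ X c → Y c ≤ Y a →
        ¬ X r + Y r < X c + Y c := fun h1 h2 h3 h4 =>
      absurd (hmax (j := c) ⟨h1, h2, h3⟩ h4.le) (not_le.2 h4)
    rcases h.layout.rect r c hrc with e | e
    · have hlt := hc e.ge
      have hcR := hr.tail ⟨hrc, e.le, hlt.le⟩
      have hac : Y a < Y c := not_le.1 fun hle => hmax' hcR (e ▸ har) hle (by linarith)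
      obtain ⟨w, hw, hw', e1, e2⟩ :=
        h.layout.exists_common_end hab hrc hY e har hrb.le hra hac.le
      have hwr : w = r := hw'.resolve_right fun e' => hac.ne (by rw [← e2, e'])
      have hwa : w = a := hw.resolve_right fun e' => hrb.ne (by rw [← e1, e'])
      have hbR := (hwa ▸ hwr ▸ hr : ReflTransGen (UpRight G X Y) u a).tail ⟨hab, hX, hY.le⟩
      exact hb ⟨b, hbR, le_rfl, le_rfl⟩
    · have hlt : X r < X c := by
        by_contra hle
        exact (hc (not_lt.1 hle)).ne e
      exact hmax' (hr.tail ⟨hrc, hlt.le, e.le⟩) (har.trans hlt.le) (e ▸ hra) (by linarith)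

theorem leftAbove_iff (h : IsGreedyConvexLayout G X Y) {u a b : V} (hab : G.Adj a b)
    (hY : Y a = Y b) {p : ℝ} (hp : p ∈ uIcc (X a) (X b)) :
    leftAbove G X Y u (X a) (Y a) ↔ leftAbove G X Y u p (Y a) := by
  have mono : ∀ {p q t}, q ≤ p → leftAbove G X Y u p t → leftAbove G X Y u q t :=
    fun hqp ⟨r, hr, h1, h2⟩ => ⟨r, hr, hqp.trans h1, h2⟩
  rcases mem_uIcc.1 hp with ⟨h1, h2⟩ | ⟨h1, h2⟩
  · refine ⟨fun ha => mono h2 ?_, mono h1⟩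
    rw [hY]
    exact h.leftAbove_right hab hY (h1.trans h2) ha
  · refine ⟨mono h2, fun ha => h.leftAbove_right hab.symm hY.symm (h1.trans h2) ?_⟩
    rw [← hY]
    exact mono h1 ha

/-- This is the only place where greediness is used, in a layout made so that a greedy path cannot
leave the height of `v`. -/
theorem leftAbove_of_le (h : IsGreedyConvexLayout G X Y) {u v : V} (hY : Y u ≤ Y v) :
    leftAbove G X Y u (X v) (Y v) := by
  classical
  by_contra hv
  have hu : leftAbove G X Y u (X u) (Y u) := ⟨u, .refl, le_rfl, le_rfl⟩
  -- Lifting the region by `Y v - Y u` brings `u` to the height of `v`, which stays put. Since the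
  -- region is closed upwards and the lift is nonnegative, the order on vertical lines survives.
  set ψ : ℝ → ℝ → ℝ := fun p q => q + if leftAbove G X Y u p q then Y v - Y u else 0 with hψ
  have hψm : ∀ p, StrictMono (ψ p) := by
    intro p q q' hqq
    have : leftAbove G X Y u p q → leftAbove G X Y u p q' := fun ⟨r, hr, h1, h2⟩ =>
      ⟨r, hr, h1, h2.trans hqq.le⟩
    simp only [hψ]
    split_ifs <;> first | linarith | tauto
  set Z : V → ℝ := fun w => ψ (X w) (Y w) with hZ
  have hZuv : Z u = Z v := by simp [hZ, hψ, hu, hv]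
  -- Stretch so far that any vertex off the height of `v` is farther from `v` than `u` is.
  obtain ⟨l, hl, hl'⟩ : ∃ l : ℝ, 0 < l ∧ ∀ w, Z w ≠ Z v →
      (X u - X v) ^ 2 < (l * Z w - l * Z v) ^ 2 := by
    have : ∀ w, ∀ᶠ l : ℝ in Filter.atTop, Z w ≠ Z v →
        (X u - X v) ^ 2 < (l * Z w - l * Z v) ^ 2 := by
      intro w
      by_cases hw : Z w = Z v
      · simp [hw]
      · have hpos : 0 < (Z w - Z v) ^ 2 := by
          have := sub_ne_zero.2 hw
          positivity
        filter_upwards [((Filter.tendsto_pow_atTop (two_ne_zero)).atTop_mul_const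
          hpos).eventually_gt_atTop ((X u - X v) ^ 2)] with l hl _
        linarith
    obtain ⟨l, h1, h2⟩ := ((Filter.eventually_gt_atTop 0).and (Filter.eventually_all.2 this)).exists
    exact ⟨l, h1, h2⟩
  obtain ⟨hd, hs⟩ := h.layout.deform (Y' := fun w => l * Z w) (φ := fun p q => l * ψ p q)
    (fun p => (hψm p).const_mul hl) (fun w => rfl) (fun a b hab p hp => by
      rcases h.layout.rect a b hab with e | e
      · rw [e, uIcc_self] at hp
        rw [mem_singleton_iff.1 hp, ← e]
      · simp only [hZ, hψ, h.leftAbove_iff hab e hp])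
  obtain ⟨p, hp⟩ := h.greedy X _ hd hs u v
  -- The end `v'` of the walk is kept apart from the target `v` of the distances, so that the
  -- induction on the walk leaves `v` fixed.
  have stay : ∀ (w v' : V) (q : G.Walk w v'), (∀ d ∈ q.darts, (X d.snd - X v) ^ 2 +
      (l * Z d.snd - l * Z v) ^ 2 < (X d.fst - X v) ^ 2 + (l * Z d.fst - l * Z v) ^ 2) →
      Z w = Z v → (X w - X v) ^ 2 ≤ (X u - X v) ^ 2 →
      leftAbove G X Y u (X w) (Y w) → leftAbove G X Y u (X v') (Y v') := by
    intro w v' q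
    induction q with
    | nil => exact fun _ _ _ hw => hw
    | @cons a b c hab q ih =>
      intro hq hw hle ha
      have hlt := hq ⟨(a, b), hab⟩ (by simp)
      simp only [hw, sub_self] at hlt
      have hb : Z b = Z v := by
        by_contra hb
        have := hl' b hb
        nlinarith [sq_nonneg (X b - X v)]
      have hYab : Y a = Y b := by
        rcases h.layout.rect a b hab with e | e
        · have : ψ (X a) (Y a) = ψ (X a) (Y b) := by
            have := hw.trans hb.symm
            simpa only [hZ, ← e] using this
          exact (hψm _).injective this
        · exact e
      refine ih (fun d hd => hq d (by simp [hd])) hb ?_ ?_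
      · nlinarith [sq_nonneg (l * Z b - l * Z v)]
      · rw [← hYab]
        exact (h.leftAbove_iff hab hYab right_mem_uIcc).1 ha
  exact hv (stay u v p hp hZuv le_rfl hu)

/-- Among the reached `r` weakly left of and above `w`, take one with `X r + Y r` least. If `r` were
strictly right of `w₁`, consider how `r` is reached. If `r = u`, then `hT` forces `u` onto the edge.
A last edge from the left contradicts minimality, and one from below meets the edge in `r`. So `r`
would be `w` or `w₁`, but neither is reached. -/
theorem leftAbove_neg_of_left (h : IsGreedyConvexLayout G X Y) {u w w₁ : V}
    (hw : ¬ ReflTransGen (UpRight G X Y) u w) (hT : leftAbove G X Y u (X w) (Y w))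
    (hS : leftAbove G Y X u (Y w) (X w)) (hadj : G.Adj w w₁) (hX : X w₁ < X w) (hY : Y w₁ = Y w) :
    leftAbove G Y X u (Y w₁) (X w₁) := by
  have hw₁ : ¬ ReflTransGen (UpRight G X Y) u w₁ := fun hR =>
    hw (hR.tail ⟨hadj.symm, hX.le, hY.le⟩)
  obtain ⟨r, ⟨hr, hwr, hrw⟩, hmin⟩ := (toFinite
    {r | ReflTransGen (UpRight G Y X) u r ∧ Y w ≤ Y r ∧ X r ≤ X w}).exists_minimalFor
      (fun r => X r + Y r) _ hS
  refine ⟨r, hr, hY ▸ hwr, ?_⟩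
  by_contra! hlt
  rcases ReflTransGen.cases_tail hr with e | ⟨c, hc, hcr, hYc, hXc⟩
  · subst e
    obtain ⟨r', hr', -, h2⟩ := hT
    have := (UpRight.le hr').2
    obtain ⟨s, hs⟩ := h.exists_adj r
    rcases h.layout.eq_or_eq_of_mem hs hadj (mem_uIcc.2 (Or.inr ⟨hlt.le, hrw⟩))
      (mem_uIcc.2 (Or.inl ⟨hwr, by linarith⟩)) with e | e
    · exact hw (e ▸ .refl)
    · exact hw₁ (e ▸ .refl)
  · have hmin' : Y w ≤ Y c → X c ≤ X w → ¬ X c + Y c < X r + Y r := fun h2 h3 h4 =>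
      absurd (hmin (j := c) ⟨hc, h2, h3⟩ h4.le) (not_le.2 h4)
    rcases h.layout.rect c r hcr with e | e
    · have hne : Y c < Y r := hYc.lt_of_ne fun e' => hcr.ne (h.layout.inj _ _ e e')
      have hcw : Y c < Y w := not_le.1 fun hle => hmin' hle (e ▸ hrw) (by linarith)
      obtain ⟨k, hk, hk', -, e2⟩ := h.layout.exists_common_end hadj.symm hcr hY e (e ▸ hlt.le)
        (e ▸ hrw) (hY ▸ hcw.le) (hY ▸ hwr)
      have hkr : k = r := hk'.resolve_left fun e' => hcw.ne (by rw [← hY, ← e2, e'])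
      subst hkr
      rcases hk with e' | e'
      · exact hw₁ (e' ▸ UpRight.swap hr)
      · exact hw (e' ▸ UpRight.swap hr)
    · have hne : X c < X r := hXc.lt_of_ne fun e' => hcr.ne (h.layout.inj _ _ e' e)
      exact hmin' (e ▸ hwr) (hne.le.trans hrw) (by linarith)

/-- A counterexample `w` with `X w + Y w` least has a left or down neighbour, as otherwise `u` in
its lower left quadrant would equal `w`. That neighbour is again a counterexample. -/
theorem reflTransGen_of_leftAbove (h : IsGreedyConvexLayout G X Y) {u v : V}
    (hT : leftAbove G X Y u (X v) (Y v)) (hS : leftAbove G Y X u (Y v) (X v)) :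
    ReflTransGen (UpRight G X Y) u v := by
  by_contra hv
  obtain ⟨w, ⟨hw, hT, hS⟩, hmin⟩ := (toFinite
    {w | ¬ ReflTransGen (UpRight G X Y) u w ∧ leftAbove G X Y u (X w) (Y w) ∧
      leftAbove G Y X u (Y w) (X w)}).exists_minimalFor (fun r => X r + Y r) _ ⟨v, hv, hT, hS⟩
  have hmin' : ∀ c, ¬ ReflTransGen (UpRight G X Y) u c → leftAbove G X Y u (X c) (Y c) →
      leftAbove G Y X u (Y c) (X c) → ¬ X c + Y c < X w + Y w := fun c h1 h2 h3 h4 =>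
    absurd (hmin (j := c) ⟨h1, h2, h3⟩ h4.le) (not_le.2 h4)
  have hTu : Y u ≤ Y w := let ⟨r, hr, _, h2⟩ := hT; (UpRight.le hr).2.trans h2
  have hSu : X u ≤ X w := let ⟨r, hr, _, h2⟩ := hS; (UpRight.le hr).2.trans h2
  by_cases hsink : ∀ c, G.Adj w c → X w ≤ X c ∧ Y w ≤ Y c
  · have := h.quadrant (-1) (-1) (Or.inr rfl) (Or.inr rfl) w u
      (fun c hc => ⟨by linarith [(hsink c hc).1], by linarith [(hsink c hc).2]⟩)
      (by linarith) (by linarith)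
    exact hw (this ▸ .refl)
  · push Not at hsink
    obtain ⟨c, hwc, hc⟩ := hsink
    have hcR : X c ≤ X w → Y c ≤ Y w → ¬ ReflTransGen (UpRight G X Y) u c := fun h1 h2 h3 =>
      hw (h3.tail ⟨hwc.symm, h1, h2⟩)
    rcases h.layout.rect w c hwc with e | e
    · have hlt := hc e.le
      have hT' := h.swap.leftAbove_neg_of_left (fun hR => hw (UpRight.swap hR)) hS hT hwc hlt e.symm
      obtain ⟨r, hr, h1, h2⟩ := hS
      exact hmin' c (hcR e.ge hlt.le) hT' ⟨r, hr, hlt.le.trans h1, e ▸ h2⟩ (by linarith)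
    · have hlt : X c < X w := by
        by_contra hle
        exact (hc (not_lt.1 hle)).ne e.symm
      have hS' := h.leftAbove_neg_of_left hw hT hS hwc hlt e.symm
      obtain ⟨r, hr, h1, h2⟩ := hT
      exact hmin' c (hcR hlt.le e.ge) ⟨r, hr, hlt.le.trans h1, e ▸ h2⟩ hS' (by linarith)

/-- Two vertices are joined by a path that leads up and right, if their relative position allows. -/
theorem reflTransGen_of_le (h : IsGreedyConvexLayout G X Y) {u v : V} (hX : X u ≤ X v)
    (hY : Y u ≤ Y v) : ReflTransGen (UpRight G X Y) u v :=
  h.reflTransGen_of_leftAbove (h.leftAbove_of_le hY) (h.swap.leftAbove_of_le hX)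

end IsGreedyConvexLayout

/-! ### Connectivity, and drawings as layouts -/

theorem IsBiconnected.preconnected {V : Type*} {G : SimpleGraph V} (hG : IsBiconnected G) :
    G.Preconnected := fun u v => by
  by_cases h : u = v
  · exact h ▸ SimpleGraph.Reachable.refl _
  · exact ⟨(hG u v h).choose⟩

theorem SimpleGraph.Preconnected.exists_adj {V : Type*} {G : SimpleGraph V} (hG : G.Preconnected)
    {u v : V} (h : u ≠ v) (w : V) : ∃ a, G.Adj w a := by
  obtain ⟨z, hz⟩ : ∃ z, w ≠ z := by
    by_cases e : w = u
    · exact ⟨v, e ▸ h⟩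
    · exact ⟨u, e⟩
  obtain ⟨p⟩ := hG w z
  cases p with
  | nil => exact absurd rfl hz
  | cons hab _ => exact ⟨_, hab⟩

/-- A property that passes to adjacent vertices holds at every vertex of a connected graph. -/
theorem SimpleGraph.Preconnected.induction {V : Type*} {G : SimpleGraph V} (hG : G.Preconnected)
    {P : V → Prop} (hP : ∀ a b, G.Adj a b → P a → P b) {u : V} (hu : P u) (v : V) : P v := by
  obtain ⟨p⟩ := hG u v
  induction p with
  | nil => exact hu
  | cons hab _ ih => exact ih (hP _ _ hab hu)

/-- One coordinate is constant, so the convex weights found for the other coordinate serve for both.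
-/
theorem mem_segment_iff_of_axis_parallel {a b z : EuclideanSpace ℝ (Fin 2)}
    (h : a 0 = b 0 ∨ a 1 = b 1) :
    z ∈ segment ℝ a b ↔ z 0 ∈ uIcc (a 0) (b 0) ∧ z 1 ∈ uIcc (a 1) (b 1) := by
  constructor
  · rintro ⟨s, t, hs, ht, hst, rfl⟩
    simp only [← segment_eq_uIcc]
    exact ⟨⟨s, t, hs, ht, hst, by simp⟩, ⟨s, t, hs, ht, hst, by simp⟩⟩
  · simp only [← segment_eq_uIcc]
    rintro ⟨⟨s, t, hs, ht, hst, h0⟩, ⟨s', t', hs', ht', hst', h1⟩⟩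
    simp only [smul_eq_mul] at h0 h1
    rcases h with e | e
    · refine ⟨s', t', hs', ht', hst', ?_⟩
      ext i
      fin_cases i
      · simp [← h0, ← e, ← add_mul, hst, hst']
      · simp [h1]
    · refine ⟨s, t, hs, ht, hst, ?_⟩
      ext i
      fin_cases i
      · simp [h0]
      · simp [← h1, ← e, ← add_mul, hst, hst']

namespace RectilinearDrawing

variable {V : Type*} {G : SimpleGraph V}

theorem mem_segment_iff (Γ : RectilinearDrawing G) {u v : V} (h : G.Adj u v)
    (z : EuclideanSpace ℝ (Fin 2)) : z ∈ segment ℝ (Γ.pos u) (Γ.pos v) ↔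
      z 0 ∈ uIcc (Γ.x u) (Γ.x v) ∧ z 1 ∈ uIcc (Γ.y u) (Γ.y v) :=
  mem_segment_iff_of_axis_parallel (Γ.rectilinear u v h)

theorem pos_ext {z w : EuclideanSpace ℝ (Fin 2)} (h0 : z 0 = w 0) (h1 : z 1 = w 1) : z = w := by
  ext i; fin_cases i
  · exact h0
  · exact h1

theorem isPlanarLayout (Γ : RectilinearDrawing G) : IsPlanarLayout G Γ.x Γ.y where
  inj _ _ h0 h1 := Γ.pos_injective (pos_ext h0 h1)
  rect := Γ.rectilinear
  planar u v a b huv hab hne p q hp hq hp' hq' := by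
    obtain ⟨w, hw, hw', e⟩ := Γ.planar u v a b huv hab hne !₂[p, q]
      ⟨(Γ.mem_segment_iff huv _).2 ⟨hp, hq⟩, (Γ.mem_segment_iff hab _).2 ⟨hp', hq'⟩⟩
    exact ⟨w, hw, hw', congrArg (· 0) e, congrArg (· 1) e⟩

/-- The drawing given by the coordinates of the vertices. -/
def ofLayout {X Y : V → ℝ} (h : IsPlanarLayout G X Y) : RectilinearDrawing G where
  pos v := !₂[X v, Y v]
  pos_injective a b e := h.inj a b (congrArg (· 0) e) (congrArg (· 1) e)
  rectilinear := h.rect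
  planar u v a b huv hab hne z hz := by
    have h1 := (mem_segment_iff_of_axis_parallel (h.rect u v huv)).1 hz.1
    have h2 := (mem_segment_iff_of_axis_parallel (h.rect a b hab)).1 hz.2
    obtain ⟨w, hw, hw', e0, e1⟩ := h.planar u v a b huv hab hne _ _ h1.1 h1.2 h2.1 h2.2
    exact ⟨w, hw, hw', pos_ext e0 e1⟩

theorem pos_mem_carrier (Γ : RectilinearDrawing G) (v : V) : Γ.pos v ∈ Γ.carrier :=
  Or.inl ⟨v, rfl⟩

theorem segment_subset_carrier (Γ : RectilinearDrawing G) {u v : V} (h : G.Adj u v) :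
    segment ℝ (Γ.pos u) (Γ.pos v) ⊆ Γ.carrier :=
  fun _ hz => Or.inr ⟨u, v, h, hz⟩

/-! ### Empty quadrants in convex drawings -/

/-- Near a vertex, the drawing consists of the edges at this vertex only. -/
theorem exists_near (Γ : RectilinearDrawing G) [Finite V] (hG : ∀ v, ∃ a, G.Adj v a) (v : V) :
    ∃ ε > 0, ∀ z ∈ Γ.carrier, |z 0 - Γ.x v| < ε → |z 1 - Γ.y v| < ε →
      ∃ a, G.Adj v a ∧ z ∈ segment ℝ (Γ.pos v) (Γ.pos a) := by
  set K : Set (EuclideanSpace ℝ (Fin 2)) :=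
    ⋃ e : {e : V × V // G.Adj e.1 e.2 ∧ v ≠ e.1 ∧ v ≠ e.2},
      segment ℝ (Γ.pos e.1.1) (Γ.pos e.1.2) with hK
  have hKc : IsClosed K := by
    refine isClosed_iUnion_of_finite fun e => ?_
    rw [← convexHull_pair]
    exact (Set.Finite.isCompact_convexHull ℝ (by simp)).isClosed
  have hvK : Γ.pos v ∉ K := by
    rw [hK, mem_iUnion]
    rintro ⟨⟨⟨a, b⟩, hab, hva, hvb⟩, hz⟩
    obtain ⟨s, hs⟩ := hG v
    have := (Γ.mem_segment_iff hab _).1 hz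
    rcases Γ.isPlanarLayout.eq_or_eq_of_mem hs hab this.1 this.2 with e | e
    exacts [hva e, hvb e]
  obtain ⟨ε, hε, hball⟩ := Metric.isOpen_iff.1 hKc.isOpen_compl _ hvK
  refine ⟨ε / 2, half_pos hε, fun z hz h0 h1 => ?_⟩
  have hzK : z ∉ K := by
    apply hball
    rw [Metric.mem_ball, EuclideanSpace.dist_eq, Real.sqrt_lt' hε, Fin.sum_univ_two]
    simp only [Real.dist_eq, sq_abs]
    have h0' := sq_lt_sq' (neg_lt_of_abs_lt h0) (lt_of_abs_lt h0)
    have h1' := sq_lt_sq' (neg_lt_of_abs_lt h1) (lt_of_abs_lt h1)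
    simp only [x, y] at h0' h1'
    nlinarith
  have hedge : ∀ a b, G.Adj a b → z ∈ segment ℝ (Γ.pos a) (Γ.pos b) →
      ∃ a, G.Adj v a ∧ z ∈ segment ℝ (Γ.pos v) (Γ.pos a) := by
    intro a b hab hz
    by_cases ha : v = a
    · exact ⟨b, ha ▸ hab, ha ▸ hz⟩
    by_cases hb : v = b
    · exact ⟨a, hb ▸ hab.symm, hb ▸ segment_symm ℝ (Γ.pos a) _ ▸ hz⟩
    exact absurd (mem_iUnion.2 ⟨⟨(a, b), hab, ha, hb⟩, hz⟩) hzK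
  rcases hz with ⟨w, rfl⟩ | ⟨a, b, hab, hz⟩
  · obtain ⟨s, hs⟩ := hG w
    exact hedge w s hs (left_mem_segment ℝ _ _)
  · exact hedge a b hab hz

/-- Three quarters of a square are the union of two overlapping convex halves. -/
theorem isPreconnected_lShape (a b : ℝ) {ε s t : ℝ} (hε : 0 < ε) (hs : s = 1 ∨ s = -1)
    (ht : t = 1 ∨ t = -1) :
    IsPreconnected {z : EuclideanSpace ℝ (Fin 2) |
      (|z 0 - a| < ε ∧ |z 1 - b| < ε) ∧ (0 < s * (z 0 - a) ∨ 0 < t * (z 1 - b))} := by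
  have half : ∀ (i : Fin 2) (r c : ℝ), (r = 1 ∨ r = -1) →
      Convex ℝ {z : EuclideanSpace ℝ (Fin 2) | 0 < r * (z i - c)} := by
    rintro i r c hr
    have hi : IsLinearMap ℝ fun z : EuclideanSpace ℝ (Fin 2) => z i := ⟨by simp, by simp⟩
    rcases hr with rfl | rfl
    · convert! convex_halfSpace_gt hi c using 3
      simp
    · convert! convex_halfSpace_lt hi c using 3
      simp
  have slab : ∀ (i : Fin 2) (c : ℝ),
      Convex ℝ {z : EuclideanSpace ℝ (Fin 2) | |z i - c| < ε} := fun i c =>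
    (convex_ball c ε).linear_preimage (EuclideanSpace.proj (𝕜 := ℝ) i).toLinearMap
  have box := (slab 0 a).inter (slab 1 b)
  rw [show {z : EuclideanSpace ℝ (Fin 2) | (|z 0 - a| < ε ∧ |z 1 - b| < ε) ∧
      (0 < s * (z 0 - a) ∨ 0 < t * (z 1 - b))} =
      {z | |z 0 - a| < ε} ∩ {z | |z 1 - b| < ε} ∩ {z | 0 < s * (z 0 - a)} ∪
      {z | |z 0 - a| < ε} ∩ {z | |z 1 - b| < ε} ∩ {z | 0 < t * (z 1 - b)} by
    rw [← inter_union_distrib_left]; rfl]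
  have hε' : |ε / 2| < ε := by rw [abs_of_pos (half_pos hε)]; exact half_lt_self hε
  refine IsPreconnected.union !₂[a + s * (ε / 2), b + t * (ε / 2)] ?_ ?_
    (box.inter (half 0 s a hs)).isPreconnected (box.inter (half 1 t b ht)).isPreconnected
  all_goals
    refine ⟨⟨?_, ?_⟩, ?_⟩ <;> rcases hs with rfl | rfl <;> rcases ht with rfl | rfl <;>
      simpa using by assumption

/-- A vertex of a convex drawing without edges into two consecutive directions is alone in the
closed quadrant spanned by these directions. -/
theorem IsConvex.quadrant [Finite V] {Γ : RectilinearDrawing G} (hΓ : Γ.IsConvex)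
    (hG : G.Preconnected) {s t : ℝ} (hs : s = 1 ∨ s = -1) (ht : t = 1 ∨ t = -1) {v u : V}
    (hv : ∀ a, G.Adj v a → s * (Γ.x a - Γ.x v) ≤ 0 ∧ t * (Γ.y a - Γ.y v) ≤ 0)
    (hx : 0 ≤ s * (Γ.x u - Γ.x v)) (hy : 0 ≤ t * (Γ.y u - Γ.y v)) : u = v := by
  by_contra huv
  have hs2 : s * s = 1 := by rcases hs with rfl | rfl <;> norm_num
  have ht2 : t * t = 1 := by rcases ht with rfl | rfl <;> norm_num
  have hsa : |s| = 1 := by rcases hs with rfl | rfl <;> norm_num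
  have hta : |t| = 1 := by rcases ht with rfl | rfl <;> norm_num
  obtain ⟨ε, hε, hnear⟩ := Γ.exists_near (hG.exists_adj huv) v
  set N : Set (EuclideanSpace ℝ (Fin 2)) := {z | (|z 0 - Γ.x v| < ε ∧ |z 1 - Γ.y v| < ε) ∧
    (0 < s * (z 0 - Γ.x v) ∨ 0 < t * (z 1 - Γ.y v))} with hN
  have hNc : N ⊆ Γ.carrierᶜ := by
    rintro z ⟨⟨h0, h1⟩, h⟩ hz
    obtain ⟨a, hva, hza⟩ := hnear z hz h0 h1
    obtain ⟨m0, m1⟩ := (Γ.mem_segment_iff hva z).1 hza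
    obtain ⟨ha0, ha1⟩ := hv a hva
    rw [mem_uIcc] at m0 m1
    rcases h with h | h
    · rcases hs with rfl | rfl <;> rcases m0 with m | m <;> linarith [m.1, m.2]
    · rcases ht with rfl | rfl <;> rcases m1 with m | m <;> linarith [m.1, m.2]
  -- points on the two rays from `v` that bound the quadrant
  set P : ℝ → EuclideanSpace ℝ (Fin 2) := fun r => !₂[Γ.x v + s * r, Γ.y v] with hP
  set Q : ℝ → EuclideanSpace ℝ (Fin 2) := fun r => !₂[Γ.x v, Γ.y v + t * r] with hQ
  have hPN : ∀ r, 0 < r → r < ε → P r ∈ N := fun r h1 h2 =>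
    ⟨by simp [hP, abs_mul, hsa, hε, abs_of_pos h1, h2], Or.inl (by simp [hP, ← mul_assoc, hs2, h1])⟩
  have hQN : ∀ r, 0 < r → r < ε → Q r ∈ N := fun r h1 h2 =>
    ⟨by simp [hQ, abs_mul, hta, hε, abs_of_pos h1, h2], Or.inr (by simp [hQ, ← mul_assoc, ht2, h1])⟩
  have hε2 := half_pos hε
  have hP₀ := hPN _ hε2 (half_lt_self hε)
  have hQ₀ := hQN _ hε2 (half_lt_self hε)
  set F := connectedComponentIn Γ.carrierᶜ (P (ε / 2)) with hF
  have hFc : F ⊆ Γ.carrierᶜ := connectedComponentIn_subset _ _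
  have hNF : N ⊆ F := (isPreconnected_lShape _ _ hε hs ht).subset_connectedComponentIn hP₀ hNc
  have hFace : Γ.IsFace F := ⟨_, hNc hP₀, rfl⟩
  have hvF : Γ.pos v ∉ F := fun h => hFc h (Γ.pos_mem_carrier v)
  -- An open rectangle that contains points of both rays also contains their corner `v`.
  have hFb : ¬ Bornology.IsBounded F := by
    intro hb
    obtain ⟨a, b, c, d, -, -, e⟩ := hΓ.1 F ⟨hFace, hb⟩
    have h1 := hNF hP₀
    have h2 := hNF hQ₀
    rw [e] at h1 h2
    apply hvF
    rw [e]
    exact ⟨h2.1, h2.2.1, h1.2.2⟩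
  have hconv := hΓ.2 F ⟨hFace, hFb⟩
  have line : ∀ (i : Fin 2) (z w : EuclideanSpace ℝ (Fin 2)), z ∉ F → w ∉ F → z i = w i →
      segment ℝ z w ⊆ Fᶜ := by
    intro i z w hz hw hzw
    have hcv : Convex ℝ (Fᶜ ∩ {p | p i = z i}) := by
      rcases hconv i (z i) with e | ⟨p, q, e⟩ <;> rw [e]
      exacts [convex_empty, convex_segment p q]
    exact (hcv.segment_subset ⟨hz, rfl⟩ ⟨hw, hzw.symm⟩).trans inter_subset_left
  -- If the ray left `F`, orthoconvexity would keep the segment back to `v` outside `F`, but near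
  -- `v` this segment runs in `N`.
  have hPF : ∀ r, 0 < r → P r ∈ F := by
    intro r hr
    by_contra hrF
    rcases lt_or_ge r ε with h | h
    · exact hrF (hNF (hPN r hr h))
    · refine line 1 _ _ hvF hrF rfl ?_ (hNF hP₀)
      refine (mem_segment_iff_of_axis_parallel (by right; rfl)).2 ⟨?_, left_mem_uIcc⟩
      rw [mem_uIcc]
      simp only [hP, x]
      rcases hs with rfl | rfl
      · left; constructor <;> simp <;> linarith
      · right; constructor <;> simp <;> linarith
  have hQF : ∀ r, 0 < r → Q r ∈ F := by
    intro r hr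
    by_contra hrF
    rcases lt_or_ge r ε with h | h
    · exact hrF (hNF (hQN r hr h))
    · refine line 0 _ _ hvF hrF rfl ?_ (hNF hQ₀)
      refine (mem_segment_iff_of_axis_parallel (by left; rfl)).2 ⟨left_mem_uIcc, ?_⟩
      rw [mem_uIcc]
      simp only [hQ, y]
      rcases ht with rfl | rfl
      · left; constructor <;> simp <;> linarith
      · right; constructor <;> simp <;> linarith
  have hPc : ∀ z ∈ Γ.carrier, z 1 = Γ.y v → s * (z 0 - Γ.x v) ≤ 0 := by
    intro z hz h1
    by_contra! h
    refine hFc (hPF _ h) ?_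
    convert hz
    refine pos_ext ?_ h1.symm
    simp [hP, ← mul_assoc, hs2]
  have hQc : ∀ z ∈ Γ.carrier, z 0 = Γ.x v → t * (z 1 - Γ.y v) ≤ 0 := by
    intro z hz h0
    by_contra! h
    refine hFc (hQF _ h) ?_
    convert hz
    refine pos_ext h0.symm ?_
    simp [hQ, ← mul_assoc, ht2]
  have hinj : ∀ c r : ℝ, (c = 1 ∨ c = -1) → c * r = 0 → r = 0 := by
    rintro c r (rfl | rfl) h <;> linarith
  have hux : 0 < s * (Γ.x u - Γ.x v) := by
    refine hx.lt_of_ne fun e => huv ?_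
    have e0 := sub_eq_zero.1 (hinj s _ hs e.symm)
    have := hinj t _ ht (le_antisymm (hQc _ (Γ.pos_mem_carrier u) e0) hy)
    exact Γ.isPlanarLayout.inj _ _ e0 (sub_eq_zero.1 this)
  have huy : 0 < t * (Γ.y u - Γ.y v) := by
    refine hy.lt_of_ne fun e => huv ?_
    have e0 := sub_eq_zero.1 (hinj t _ ht e.symm)
    have := hinj s _ hs (le_antisymm (hPc _ (Γ.pos_mem_carrier u) e0) hx)
    exact Γ.isPlanarLayout.inj _ _ (sub_eq_zero.1 this) e0
  -- The drawing avoids both rays, so no edge leaves the open quadrant. By connectivity a vertex `u`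
  -- in it would pull `v` in as well.
  have := hG.induction (P := fun w => 0 < s * (Γ.x w - Γ.x v) ∧ 0 < t * (Γ.y w - Γ.y v))
    (fun a b hab ⟨h0, h1⟩ => ?_) ⟨hux, huy⟩ v
  · simp at this
  · rcases Γ.rectilinear a b hab with e | e
    · have e' : Γ.x a = Γ.x b := e
      refine ⟨e' ▸ h0, ?_⟩
      by_contra! hb
      refine absurd (hPc !₂[Γ.x a, Γ.y v] (Γ.segment_subset_carrier hab
        ((Γ.mem_segment_iff hab _).2 ⟨left_mem_uIcc, ?_⟩)) rfl) (not_le.2 h0)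
      rw [mem_uIcc]
      rcases ht with rfl | rfl
      · right; constructor <;> simp <;> linarith
      · left; constructor <;> simp <;> linarith
    · have e' : Γ.y a = Γ.y b := e
      refine ⟨?_, e' ▸ h1⟩
      by_contra! hb
      refine absurd (hQc !₂[Γ.x v, Γ.y a] (Γ.segment_subset_carrier hab
        ((Γ.mem_segment_iff hab _).2 ⟨?_, left_mem_uIcc⟩)) rfl) (not_le.2 h1)
      rw [mem_uIcc]
      rcases hs with rfl | rfl
      · right; constructor <;> simp <;> linarith
      · left; constructor <;> simp <;> linarith

end RectilinearDrawing

/-! ### Directions, shape equivalence and staircases -/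

namespace RectilinearDrawing

variable {V : Type*} {G : SimpleGraph V}

theorem dir_cases (Γ : RectilinearDrawing G) {v a : V} (h : G.Adj v a) :
    (Γ.dir v a = 0 ∧ Γ.x v < Γ.x a ∧ Γ.y v = Γ.y a) ∨
    (Γ.dir v a = 1 ∧ Γ.x v = Γ.x a ∧ Γ.y v < Γ.y a) ∨
    (Γ.dir v a = 2 ∧ Γ.x a < Γ.x v ∧ Γ.y v = Γ.y a) ∨
    (Γ.dir v a = 3 ∧ Γ.x v = Γ.x a ∧ Γ.y a < Γ.y v) := by
  have hL := Γ.isPlanarLayout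
  unfold dir
  by_cases hy : Γ.y a = Γ.y v
  · have hx : Γ.x a ≠ Γ.x v := fun hx => h.ne' (hL.inj _ _ hx hy)
    rcases hx.lt_or_gt with hx | hx
    · simp [hy, hx, hx.not_gt]
    · simp [hy, hx]
  · have hx : Γ.x v = Γ.x a := (hL.rect v a h).resolve_right fun e => hy e.symm
    rcases Ne.lt_or_gt hy with hy | hy
    · simp [hx, hy, hy.ne, hy.not_gt]
    · simp [hx, hy, hy.ne']

theorem dir_symm (Γ : RectilinearDrawing G) {v a : V} (h : G.Adj v a) :
    Γ.dir a v = Γ.dir v a + 2 := by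
  rcases Γ.dir_cases h with ⟨e, h1, h2⟩ | ⟨e, h1, h2⟩ | ⟨e, h1, h2⟩ | ⟨e, h1, h2⟩ <;>
    rcases Γ.dir_cases h.symm with ⟨e', h1', h2'⟩ | ⟨e', h1', h2'⟩ | ⟨e', h1', h2'⟩ |
      ⟨e', h1', h2'⟩ <;>
    first
      | (exfalso; linarith)
      | (rw [e, e']; decide)

/-- Shape equivalent drawings of a connected graph differ by a rotation of all directions. -/
theorem ShapeEquivalent.exists_rotation (hG : G.Preconnected) {Γ Γ' : RectilinearDrawing G}
    (h : Γ.ShapeEquivalent Γ') : ∃ k, ∀ v a, G.Adj v a → Γ'.dir v a = Γ.dir v a + k := by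
  by_cases hE : ∃ r s, G.Adj r s
  · obtain ⟨r, s, hrs⟩ := hE
    -- Equal angles carry the rotation from one edge at `v` to all edges at `v`; reversing an edge
    -- adds `2` in both drawings and carries it to the neighbour.
    have spread : ∀ k v w, G.Adj v w → Γ'.dir v w = Γ.dir v w + k →
        ∀ a, G.Adj v a → Γ'.dir v a = Γ.dir v a + k := by
      intro k v w hvw e a hva
      have := h v a w hva hvw
      unfold angle at this
      linear_combination e - this
    refine ⟨Γ'.dir r s - Γ.dir r s, fun v => hG.induction (P := fun v => ∀ a, G.Adj v a →
      Γ'.dir v a = Γ.dir v a + (Γ'.dir r s - Γ.dir r s)) (fun v w hvw hv => ?_)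
      (spread _ r s hrs (by ring)) v⟩
    refine spread _ w v hvw.symm ?_
    rw [Γ.dir_symm hvw, Γ'.dir_symm hvw, hv w hvw]
    ring
  · exact ⟨0, fun v a hva => absurd ⟨v, a, hva⟩ hE⟩

/-- A path on which only two consecutive directions occur is a staircase. -/
theorem isStaircase_of_dir (Γ : RectilinearDrawing G) {u v : V} {p : G.Walk u v} (hp : p.IsPath)
    {k : ZMod 4} (h : ∀ d ∈ p.darts, Γ.dir d.fst d.snd = k ∨ Γ.dir d.fst d.snd = k + 1) :
    Γ.IsStaircase p := by
  have hk : ∀ k : ZMod 4, k = 0 ∨ k = 1 ∨ k = 2 ∨ k = 3 := by decide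
  refine ⟨hp, ?_, ?_⟩
  · rcases hk k with rfl | rfl | rfl | rfl
    on_goal 1 => left
    on_goal 2 => right
    on_goal 3 => right
    on_goal 4 => left
    all_goals
      intro d hd
      have hd' := h d hd
      rcases Γ.dir_cases d.adj with ⟨e, h1, h2⟩ | ⟨e, h1, h2⟩ | ⟨e, h1, h2⟩ | ⟨e, h1, h2⟩ <;>
        first | linarith | (rw [e] at hd'; exact absurd hd' (by decide))
  · rcases hk k with rfl | rfl | rfl | rfl
    on_goal 1 => left
    on_goal 2 => left
    on_goal 3 => right
    on_goal 4 => right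
    all_goals
      intro d hd
      have hd' := h d hd
      rcases Γ.dir_cases d.adj with ⟨e, h1, h2⟩ | ⟨e, h1, h2⟩ | ⟨e, h1, h2⟩ | ⟨e, h1, h2⟩ <;>
        first | linarith | (rw [e] at hd'; exact absurd hd' (by decide))

theorem shapeEquivalent_ofLayout (Γ : RectilinearDrawing G) {X Y : V → ℝ}
    (h : IsPlanarLayout G X Y) (hd : SameDirections G Γ.x Γ.y X Y) :
    Γ.ShapeEquivalent (ofLayout h) := by
  have key : ∀ v a, G.Adj v a → Γ.dir v a = (ofLayout h).dir v a := by
    intro v a hva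
    have h1 := hd v a hva
    have h2 := hd a v hva.symm
    have hx : (ofLayout h).x = X := rfl
    have hy : (ofLayout h).y = Y := rfl
    have hY : Γ.y a = Γ.y v ↔ Y a = Y v := by
      simp only [le_antisymm_iff, ← not_lt, h1.2, h2.2]
    simp only [dir, hx, hy, hY, h1.1, h1.2]
  intro v a b ha hb
  rw [angle, angle, key v a ha, key v b hb]

/-- If all drawings of the same shape are greedy, then the layout of a convex drawing is a greedy
convex layout. -/
theorem IsConvex.isGreedyConvexLayout [Finite V] {Γ : RectilinearDrawing G} (hΓ : Γ.IsConvex)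
    (hG : G.Preconnected) (hgreedy : ∀ Γ' : RectilinearDrawing G, Γ.ShapeEquivalent Γ' →
      Γ'.IsGreedy) {u v : V} (huv : u ≠ v) : IsGreedyConvexLayout G Γ.x Γ.y where
  layout := Γ.isPlanarLayout
  quadrant s t hs ht v u hv hx hy := hΓ.quadrant hG hs ht hv hx hy
  exists_adj := hG.exists_adj huv
  greedy X Y h hd a b := by
    obtain ⟨p, -, hp⟩ := hgreedy _ (Γ.shapeEquivalent_ofLayout h hd) a b
    refine ⟨p, fun d hd => ?_⟩
    have := hp d hd
    rw [EuclideanSpace.dist_eq, EuclideanSpace.dist_eq, Fin.sum_univ_two, Fin.sum_univ_two,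
      Real.sqrt_lt_sqrt_iff (by positivity)] at this
    simpa [Real.dist_eq, sq_abs, ofLayout] using this

theorem exists_path_of_reflTransGen {r : V → V → Prop} (hr : ∀ a b, r a b → G.Adj a b) {u v : V}
    (h : ReflTransGen r u v) : ∃ p : G.Walk u v, p.IsPath ∧ ∀ d ∈ p.darts, r d.fst d.snd := by
  classical
  obtain ⟨p, hp⟩ : ∃ p : G.Walk u v, ∀ d ∈ p.darts, r d.fst d.snd := by
    induction h using ReflTransGen.head_induction_on with
    | refl => exact ⟨.nil, by simp⟩
    | head hab _ ih =>
      obtain ⟨p, hp⟩ := ih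
      exact ⟨.cons (hr _ _ hab) p, by simpa using ⟨hab, hp⟩⟩
  exact ⟨p.bypass, p.bypass_isPath, fun d hd => hp d (p.darts_bypass_subset_darts hd)⟩

/-- If all drawings of the same shape are greedy, then in a convex drawing any two vertices are
joined by a path on which only two consecutive directions occur. -/
theorem IsConvex.exists_path [Finite V] {Γ : RectilinearDrawing G} (hΓ : Γ.IsConvex)
    (hG : G.Preconnected) (hgreedy : ∀ Γ' : RectilinearDrawing G, Γ.ShapeEquivalent Γ' →
      Γ'.IsGreedy) (u v : V) : ∃ (k : ZMod 4) (p : G.Walk u v), p.IsPath ∧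
      ∀ d ∈ p.darts, Γ.dir d.fst d.snd = k ∨ Γ.dir d.fst d.snd = k + 1 := by
  by_cases huv : u = v
  · subst huv
    exact ⟨0, .nil, by simp, by simp⟩
  have hL := hΓ.isGreedyConvexLayout hG hgreedy huv
  have build : ∀ (X Y : V → ℝ) (k : ZMod 4), IsGreedyConvexLayout G X Y → X u ≤ X v → Y u ≤ Y v →
      (∀ a b, UpRight G X Y a b → Γ.dir a b = k ∨ Γ.dir a b = k + 1) →
      ∃ (k : ZMod 4) (p : G.Walk u v), p.IsPath ∧
        ∀ d ∈ p.darts, Γ.dir d.fst d.snd = k ∨ Γ.dir d.fst d.snd = k + 1 := by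
    intro X Y k h hX hY hk
    obtain ⟨p, hp, hd⟩ := exists_path_of_reflTransGen (fun _ _ h => h.1)
      (h.reflTransGen_of_le hX hY)
    exact ⟨k, p, hp, fun d hd' => hk _ _ (hd d hd')⟩
  -- Reflections reduce each relative position to the up-right one; `k` and `k + 1` are the
  -- directions in `Γ` that become right and up in some order.
  rcases le_total (Γ.x u) (Γ.x v) with hx | hx <;> rcases le_total (Γ.y u) (Γ.y v) with hy | hy
  · refine build _ _ 0 hL hx hy ?_
    rintro a b ⟨hab, h1, h2⟩
    rcases Γ.dir_cases hab with ⟨e, h1', h2'⟩ | ⟨e, h1', h2'⟩ | ⟨e, h1', h2'⟩ | ⟨e, h1', h2'⟩ <;>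
      first | (exfalso; linarith) | (rw [e]; decide)
  · refine build _ _ 3 hL.swap.neg.swap hx (neg_le_neg hy) ?_
    rintro a b ⟨hab, h1, h2⟩
    rcases Γ.dir_cases hab with ⟨e, h1', h2'⟩ | ⟨e, h1', h2'⟩ | ⟨e, h1', h2'⟩ | ⟨e, h1', h2'⟩ <;>
      first | (exfalso; linarith) | (rw [e]; decide)
  · refine build _ _ 1 hL.neg (neg_le_neg hx) hy ?_
    rintro a b ⟨hab, h1, h2⟩
    rcases Γ.dir_cases hab with ⟨e, h1', h2'⟩ | ⟨e, h1', h2'⟩ | ⟨e, h1', h2'⟩ | ⟨e, h1', h2'⟩ <;>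
      first | (exfalso; linarith) | (rw [e]; decide)
  · refine build _ _ 2 hL.neg.swap.neg.swap (neg_le_neg hx) (neg_le_neg hy) ?_
    rintro a b ⟨hab, h1, h2⟩
    rcases Γ.dir_cases hab with ⟨e, h1', h2'⟩ | ⟨e, h1', h2'⟩ | ⟨e, h1', h2'⟩ | ⟨e, h1', h2'⟩ <;>
      first | (exfalso; linarith) | (rw [e]; decide)

/-- A coordinate that is monotone along the path stays on one side of its final value. -/
theorem abs_sub_antitone_of_monotone {f : V → ℝ} {u v : V} (p : G.Walk u v)
    (h : (∀ d ∈ p.darts, f d.fst ≤ f d.snd) ∨ ∀ d ∈ p.darts, f d.snd ≤ f d.fst) :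
    ∀ d ∈ p.darts, |f d.snd - f v| ≤ |f d.fst - f v| ∧
      (|f d.snd - f v| = |f d.fst - f v| → f d.snd = f d.fst) := by
  have aux : ∀ (f : V → ℝ) (u v : V) (p : G.Walk u v), (∀ d ∈ p.darts, f d.fst ≤ f d.snd) →
      f u ≤ f v ∧ ∀ d ∈ p.darts, f d.snd ≤ f v := by
    intro f u v p
    induction p with
    | nil => simp
    | cons hab p ih =>
      intro h
      simp only [SimpleGraph.Walk.darts_cons, List.mem_cons, forall_eq_or_imp] at h ⊢
      have := ih h.2
      exact ⟨h.1.trans this.1, this⟩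
  intro d hd
  rcases h with h | h
  · have h1 := h d hd
    have h2 := (aux f u v p h).2 d hd
    rw [abs_of_nonpos (by linarith), abs_of_nonpos (by linarith)]
    exact ⟨by linarith, fun e => by linarith⟩
  · have h1 := h d hd
    have h2 := (aux (fun v => -f v) u v p fun d hd => neg_le_neg (h d hd)).2 d hd
    rw [abs_of_nonneg (by linarith), abs_of_nonneg (by linarith)]
    exact ⟨by linarith, fun e => by linarith⟩

theorem IsStaircase.isDistanceDecreasing {Γ : RectilinearDrawing G} {u v : V} {p : G.Walk u v}
    (h : Γ.IsStaircase p) : Γ.IsDistanceDecreasing p := by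
  refine ⟨h.1, fun d hd => ?_⟩
  obtain ⟨hx, hx'⟩ := abs_sub_antitone_of_monotone p h.2.1 d hd
  obtain ⟨hy, hy'⟩ := abs_sub_antitone_of_monotone p h.2.2 d hd
  have key : (Γ.x d.snd - Γ.x v) ^ 2 + (Γ.y d.snd - Γ.y v) ^ 2 <
      (Γ.x d.fst - Γ.x v) ^ 2 + (Γ.y d.fst - Γ.y v) ^ 2 := by
    have h1 := sq_le_sq.2 hx
    have h2 := sq_le_sq.2 hy
    refine lt_of_le_of_ne (add_le_add h1 h2) fun e => ?_
    have e1 := hx' (sq_eq_sq_iff_abs_eq_abs _ _ |>.1 (by linarith))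
    have e2 := hy' (sq_eq_sq_iff_abs_eq_abs _ _ |>.1 (by linarith))
    -- Equality would leave both coordinates unchanged along an edge.
    exact d.adj.ne' (Γ.isPlanarLayout.inj _ _ e1 e2)
  rw [EuclideanSpace.dist_eq, EuclideanSpace.dist_eq, Fin.sum_univ_two, Fin.sum_univ_two,
    Real.sqrt_lt_sqrt_iff (by positivity)]
  simpa [Real.dist_eq, sq_abs, x, y] using key

end RectilinearDrawing

theorem mainTheorem11 {V : Type*} [Finite V] (G : SimpleGraph V) (hG : IsBiconnected G)
    (H : RectilinearRepresentation G) (hH : H.IsConvex) :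
    H.IsUniversalGreedy ↔ ∀ u v : V, ∃ p : G.Walk u v, H.IsStaircase p := by
  obtain ⟨Γ, rfl, hΓ⟩ := hH
  have hH : ∀ Γ' : RectilinearDrawing G,
      RectilinearRepresentation.IsDrawing (Quotient.mk (shapeSetoid G) Γ) Γ' ↔
        Γ.ShapeEquivalent Γ' := fun Γ' => eq_comm.trans Quotient.eq
  constructor
  · intro h u v
    obtain ⟨k, p, hp, hd⟩ := hΓ.exists_path hG.preconnected
      (fun Γ' hΓ' => h Γ' ((hH Γ').2 hΓ')) u v
    refine ⟨p, fun Γ' hΓ' => ?_⟩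
    obtain ⟨l, hl⟩ := ((hH Γ').1 hΓ').exists_rotation hG.preconnected
    -- Rotation by `l` turns the two consecutive directions into two consecutive directions.
    refine Γ'.isStaircase_of_dir hp (k := k + l) fun d hd' => ?_
    rw [hl _ _ d.adj, add_right_comm k l 1]
    exact (hd d hd').imp (congrArg (· + l)) (congrArg (· + l))
  · intro h Γ' hΓ' u v
    obtain ⟨p, hp⟩ := h u v
    exact ⟨p, (hp Γ' hΓ').isDistanceDecreasing⟩
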